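/- Let $k$ be an algebraically closed field of characteristic $p>0$, let $V$ be a finite-dimensional $k$-vector space of dimension $d$, and let $G\subset GL(V)$ be a finite subgroup with $p\nmid \#G$. Let $S=S^{\bullet}V$ be the symmetric algebra of $V$ (a polynomial ring in $d$ variables over $k$) with the natural action of $G$, let $R=S^{G}$ be the invariant ring, and let $\mathfrak m=S^{>0}V\subset S$ be the homogeneous maximal ideal. For $e\in\mathbb Z_{\ge 0}$ put $q=p^{e}$, $S^{q}=\{f^{q}\mid f\in S\}$, $R^{q}=\{f^{q}\mid f\in R\}$, let $\mathfrak m^{[q]}\subset S$ be the ideal generated by all $f^{q}$ with $f\in\mathfrak m$, and put $D_{R,e}=\mathrm{End}_{R^{q}}(R)$. For a ring $A$, let $A\text{-}\mathbf{mod}$ be the category of left $A$-modules. Call $q$ large enough if the $G$-representation $S/\mathfrak m^{[q]}$ contains every irreducible representation of $G$ over $k$ as a direct summand. 1. If $q$ is large enough, the functors $$\Phi=\mathrm{Hom}_{R^{q}}(S^{q},R)\otimes_{\mathrm{End}_{R^{q}}(S^{q})}-\;:\;\mathrm{End}_{R^{q}}(S^{q})\text{-}\mathbf{mod}\to D_{R,e}\text{-}\mathbf{mod}$$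 and $$\mathrm{Hom}_{R^{q}}(R,S^{q})\otimes_{D_{R,e}}-\;:\;D_{R,e}\text{-}\mathbf{mod}\to \mathrm{End}_{R^{q}}(S^{q})\text{-}\mathbf{mod}$$ are equivalences, inverse to each other up to natural isomorphism, and they are $R^{q}$-linear; that is, they form a Morita equivalence of $R^{q}$-algebras between $\mathrm{End}_{R^{q}}(S^{q})$ and $D_{R,e}$. Moreover, the rings $\mathrm{End}_{R}(S)$ and $D_{R,e}$ are Morita equivalent, that is, there is an additive equivalence $\mathrm{End}_{R}(S)\text{-}\mathbf{mod}\cong D_{R,e}\text{-}\mathbf{mod}$. 2. There is $e_{0}$ such that $q=p^{e}$ is large enough for every $e\ge e_{0}$. 3. If $G$ is abelian, then every $q=p^{e}\ge \#G$ is large enough. -/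

import Mathlib

universe u v

open CategoryTheory TensorProduct

noncomputable section

section HomTensor

variable (R : Type v) [CommRing R]
  (M N : Type u) [AddCommGroup M] [Module R M] [AddCommGroup N] [Module R N]

/-- The relations `(f ∘ a) ⊗ x = f ⊗ (a • x)`, for `a ∈ End_R(M)`, that cut out
`Hom_R(M, N) ⊗_{End_R(M)} X` from the tensor product over `ℤ`. Here `Hom_R(M, N)` is the
`(End_R(N), End_R(M))`-bimodule given by composition on either side. -/
def homTensorRel (X : Type u) [AddCommGroup X] [Module (Module.End R M) X] :
    Submodule (Module.End R N) ((M →ₗ[R] N) ⊗[ℤ] X) :=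
  Submodule.span (Module.End R N)
    {t | ∃ (f : M →ₗ[R] N) (a : Module.End R M) (x : X),
      t = (f ∘ₗ a) ⊗ₜ[ℤ] x - f ⊗ₜ[ℤ] (a • x)}

/-- The left `End_R(N)`-module `Hom_R(M, N) ⊗_{End_R(M)} X`, for a left `End_R(M)`-module `X`. -/
abbrev HomTensor (X : Type u) [AddCommGroup X] [Module (Module.End R M) X] : Type u :=
  ((M →ₗ[R] N) ⊗[ℤ] X) ⧸ homTensorRel R M N X

/-- The left `End_R(N)`-span of the relations is just the additive subgroup they generate, so
`HomTensor` is the usual tensor product over the ring `End_R(M)`. -/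
theorem homTensorRel_toAddSubgroup (X : Type u) [AddCommGroup X] [Module (Module.End R M) X] :
    (homTensorRel R M N X).toAddSubgroup = AddSubgroup.closure
      {t | ∃ (f : M →ₗ[R] N) (a : Module.End R M) (x : X),
        t = (f ∘ₗ a) ⊗ₜ[ℤ] x - f ⊗ₜ[ℤ] (a • x)} := by
  apply le_antisymm
  · intro t ht
    refine Submodule.span_induction (p := fun t _ => t ∈ AddSubgroup.closure _)
      (fun t h => AddSubgroup.subset_closure h) (zero_mem _) (fun _ _ _ _ hx hy => add_mem hx hy)
      (fun b t ht' h => ?_) ht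
    clear ht'
    induction h using AddSubgroup.closure_induction with
    | mem t h =>
      obtain ⟨f, a, x, rfl⟩ := h
      refine AddSubgroup.subset_closure ⟨b ∘ₗ f, a, x, ?_⟩
      rw [smul_sub, TensorProduct.smul_tmul', TensorProduct.smul_tmul']
      rfl
    | zero => rw [smul_zero]; exact zero_mem _
    | add x y _ _ hx hy => rw [smul_add]; exact add_mem hx hy
    | neg x _ hx => rw [smul_neg]; exact neg_mem hx
  · rw [AddSubgroup.closure_le]
    exact fun t ht => Submodule.subset_span ht

variable {X Y Z : Type u} [AddCommGroup X] [Module (Module.End R M) X]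
  [AddCommGroup Y] [Module (Module.End R M) Y] [AddCommGroup Z] [Module (Module.End R M) Z]

/-- The `End_R(N)`-linear map `f ⊗ x ↦ f ⊗ φ x` before passing to the quotients. -/
def homTensorPreMap (φ : X →ₗ[Module.End R M] Y) :
    ((M →ₗ[R] N) ⊗[ℤ] X) →ₗ[Module.End R N] ((M →ₗ[R] N) ⊗[ℤ] Y) :=
  TensorProduct.AlgebraTensorModule.map (LinearMap.id : (M →ₗ[R] N) →ₗ[Module.End R N] (M →ₗ[R] N))
    (φ.toAddMonoidHom.toIntLinearMap)

theorem homTensorPreMap_tmul (φ : X →ₗ[Module.End R M] Y) (f : M →ₗ[R] N) (x : X) :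
    homTensorPreMap R M N φ (f ⊗ₜ[ℤ] x) = f ⊗ₜ[ℤ] φ x := rfl

theorem homTensorRel_le_comap (φ : X →ₗ[Module.End R M] Y) :
    homTensorRel R M N X ≤ (homTensorRel R M N Y).comap (homTensorPreMap R M N φ) := by
  refine Submodule.span_le.2 ?_
  rintro _ ⟨f, a, x, rfl⟩
  refine Submodule.subset_span ⟨f, a, φ x, ?_⟩
  rw [map_sub, homTensorPreMap_tmul, homTensorPreMap_tmul, map_smul]

/-- The map `Hom_R(M, N) ⊗ φ`. -/
def homTensorMap (φ : X →ₗ[Module.End R M] Y) :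
    HomTensor R M N X →ₗ[Module.End R N] HomTensor R M N Y :=
  Submodule.mapQ _ _ (homTensorPreMap R M N φ) (homTensorRel_le_comap R M N φ)

theorem homTensor_hom_ext {P : Type u} [AddCommGroup P] [Module (Module.End R N) P]
    {α β : HomTensor R M N X →ₗ[Module.End R N] P}
    (h : ∀ (f : M →ₗ[R] N) (x : X),
      α (Submodule.Quotient.mk (f ⊗ₜ[ℤ] x)) = β (Submodule.Quotient.mk (f ⊗ₜ[ℤ] x))) : α = β := by
  refine LinearMap.ext fun t => ?_
  obtain ⟨t, rfl⟩ := Submodule.Quotient.mk_surjective _ t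
  induction t with
  | zero => rw [Submodule.Quotient.mk_zero, map_zero, map_zero]
  | add x y hx hy => rw [Submodule.Quotient.mk_add, map_add, map_add, hx, hy]
  | tmul f x => exact h f x

/-- The functor `Hom_R(M, N) ⊗_{End_R(M)} - : End_R(M)-mod ⥤ End_R(N)-mod`. -/
def homTensorFunctor : ModuleCat.{u} (Module.End R M) ⥤ ModuleCat.{u} (Module.End R N) where
  obj X := ModuleCat.of _ (HomTensor R M N X)
  map φ := ModuleCat.ofHom (homTensorMap R M N φ.hom)
  map_id X := by
    apply ModuleCat.hom_ext
    exact homTensor_hom_ext R M N fun f x => rfl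
  map_comp φ ψ := by
    apply ModuleCat.hom_ext
    exact homTensor_hom_ext R M N fun f x => rfl

end HomTensor

section Invariants

variable {k : Type u} [Field k] {V : Type v} [AddCommGroup V] [Module k V]

instance symmetricAlgebraCharP (p : ℕ) [CharP k p] : CharP (SymmetricAlgebra k V) p :=
  charP_of_injective_algebraMap (algebraMap k (SymmetricAlgebra k V)).injective p

/-- The natural action of `GL(V)` on the symmetric algebra of `V`:
the algebra endomorphism extending `g : V → V`. -/
def symAct (g : V ≃ₗ[k] V) : SymmetricAlgebra k V →ₐ[k] SymmetricAlgebra k V :=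
  SymmetricAlgebra.lift (SymmetricAlgebra.ι k V ∘ₗ (g : V →ₗ[k] V))

theorem symAct_one : symAct (1 : V ≃ₗ[k] V) = AlgHom.id k _ := by
  apply SymmetricAlgebra.algHom_ext
  ext x
  simp [symAct]

theorem symAct_mul (g h : V ≃ₗ[k] V) : symAct (g * h) = (symAct g).comp (symAct h) := by
  apply SymmetricAlgebra.algHom_ext
  ext x
  simp [symAct]

variable (G : Subgroup (V ≃ₗ[k] V)) (p e : ℕ)

/-- The invariant ring `R = S^G` of `S = Sym(V)`. -/
def invariantRing : Subalgebra k (SymmetricAlgebra k V) where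
  carrier := {f | ∀ g ∈ G, symAct g f = f}
  mul_mem' ha hb g hg := by rw [map_mul, ha g hg, hb g hg]
  add_mem' ha hb g hg := by rw [map_add, ha g hg, hb g hg]
  algebraMap_mem' r g _ := (symAct g).commutes r

variable (k V) in
/-- The homogeneous maximal ideal `𝔪 = S^{>0} V` of `S`, generated by `V`. -/
def symMaxIdeal : Ideal (SymmetricAlgebra k V) :=
  Ideal.span (Set.range (SymmetricAlgebra.ι k V))

variable (k V) in
/-- The Frobenius power `𝔪^[q]`, the ideal generated by all `f^q` with `f ∈ 𝔪`. -/
def symFrobPower : Ideal (SymmetricAlgebra k V) :=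
  Ideal.span {s | ∃ f ∈ symMaxIdeal k V, f ^ p ^ e = s}

theorem symAct_mem_symMaxIdeal (g : V ≃ₗ[k] V) {f : SymmetricAlgebra k V}
    (hf : f ∈ symMaxIdeal k V) : symAct g f ∈ symMaxIdeal k V := by
  have h : symMaxIdeal k V ≤ (symMaxIdeal k V).comap (symAct g) := by
    refine Ideal.span_le.2 ?_
    rintro _ ⟨x, rfl⟩
    refine Ideal.subset_span ⟨g x, ?_⟩
    simp [symAct]
  exact h hf

theorem symFrobPower_le_comap (g : V ≃ₗ[k] V) :
    symFrobPower k V p e ≤ (symFrobPower k V p e).comap (symAct g) := by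
  refine Ideal.span_le.2 ?_
  rintro _ ⟨f, hf, rfl⟩
  exact Ideal.subset_span ⟨symAct g f, symAct_mem_symMaxIdeal g hf, (map_pow _ _ _).symm⟩

/-- The action of `g ∈ GL(V)` on `S / 𝔪^[q]` induced by the action on `S`. -/
def frobQuotAct (g : V ≃ₗ[k] V) :
    (SymmetricAlgebra k V ⧸ symFrobPower k V p e) →ₐ[k]
      (SymmetricAlgebra k V ⧸ symFrobPower k V p e) :=
  Ideal.quotientMapₐ (symFrobPower k V p e) (symAct g) (symFrobPower_le_comap p e g)

theorem frobQuotAct_mk (g : V ≃ₗ[k] V) (f : SymmetricAlgebra k V) :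
    frobQuotAct p e g (Ideal.Quotient.mk _ f) = Ideal.Quotient.mk _ (symAct g f) := rfl

/-- The representation of `G` on `S / 𝔪^[q]` induced by the action on `S`. -/
def frobQuotRep : Representation k G (SymmetricAlgebra k V ⧸ symFrobPower k V p e) where
  toFun g := (frobQuotAct p e (g : V ≃ₗ[k] V)).toLinearMap
  map_one' := by
    refine LinearMap.ext fun t => ?_
    obtain ⟨f, rfl⟩ := Ideal.Quotient.mk_surjective t
    change frobQuotAct p e 1 (Ideal.Quotient.mk _ f) = Ideal.Quotient.mk _ f
    rw [frobQuotAct_mk, symAct_one, AlgHom.id_apply]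
  map_mul' g h := by
    refine LinearMap.ext fun t => ?_
    obtain ⟨f, rfl⟩ := Ideal.Quotient.mk_surjective t
    change frobQuotAct p e ((g : V ≃ₗ[k] V) * (h : V ≃ₗ[k] V)) (Ideal.Quotient.mk _ f) =
      frobQuotAct p e g (frobQuotAct p e h (Ideal.Quotient.mk _ f))
    rw [frobQuotAct_mk, frobQuotAct_mk, frobQuotAct_mk, symAct_mul, AlgHom.comp_apply]

/-- `q = p^e` is large for `G`: the representation `S / 𝔪^[q]` contains every irreducible
representation of `G` over `k` as a direct summand. -/
def IsLargeFrob : Prop :=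
  ∀ (U : Type u) [AddCommGroup U] [Module k U] [FiniteDimensional k U]
    (ρ : Representation k G U), ρ.IsIrreducible →
    ∃ (i : ρ.IntertwiningMap (frobQuotRep G p e)) (r : (frobQuotRep G p e).IntertwiningMap ρ),
      ∀ x, r (i x) = x

variable [Fact p.Prime] [CharP k p]

/-- The ring `R^q = {f^q | f ∈ R}`, `q = p^e`, as a subring of `S`. -/
def invariantFrob : Subring (SymmetricAlgebra k V) :=
  (invariantRing G).toSubring.map (iterateFrobenius (SymmetricAlgebra k V) p e)

theorem mem_invariantFrob {s : SymmetricAlgebra k V} :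
    s ∈ invariantFrob G p e ↔ ∃ f ∈ invariantRing G, f ^ p ^ e = s := Iff.rfl

/-- `R`, as an `R^q`-submodule of `S`. -/
def invariantModule : Submodule (invariantFrob G p e) (SymmetricAlgebra k V) where
  carrier := invariantRing G
  add_mem' ha hb := add_mem ha hb
  zero_mem' := zero_mem _
  smul_mem' c x hx := by
    obtain ⟨_, f, hf, rfl⟩ := c
    exact mul_mem (pow_mem hf _) hx

/-- `S^q = {f^q | f ∈ S}`, as an `R^q`-submodule of `S`. -/
def symFrobModule : Submodule (invariantFrob G p e) (SymmetricAlgebra k V) where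
  carrier := {s | ∃ f : SymmetricAlgebra k V, f ^ p ^ e = s}
  add_mem' := by
    rintro _ _ ⟨f, rfl⟩ ⟨g, rfl⟩
    exact ⟨f + g, map_add (iterateFrobenius (SymmetricAlgebra k V) p e) f g⟩
  zero_mem' := ⟨0, map_zero (iterateFrobenius (SymmetricAlgebra k V) p e)⟩
  smul_mem' := by
    rintro ⟨_, f, hf, rfl⟩ _ ⟨g, rfl⟩
    exact ⟨f * g, map_mul (iterateFrobenius (SymmetricAlgebra k V) p e) f g⟩

/-- `D_{R,e} = End_{R^q}(R)`. -/
abbrev diffOpRing : Type (max u v) :=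
  Module.End (invariantFrob G p e) (invariantModule G p e)

/-- `End_{R^q}(S^q)`. -/
abbrev symFrobEnd : Type (max u v) :=
  Module.End (invariantFrob G p e) (symFrobModule G p e)

end Invariants

end

-- Two modules over a commutative ring, each a direct summand of a finite power of the other, have
-- Morita equivalent endomorphism rings. Part 1 therefore asks for two finite decompositions of the
-- identity, one of `R` through copies of `S^q` and one of `S^q` through copies of `R`.
--
-- Since `k` is perfect, `S` is free over `S^q` on the reduced monomials `b_j`, with coordinates
-- `c_j(x)^q`. For `R` this gives `x = ∑ c_j(x)^q b_j`, and averaging over `G` turns it into a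
-- decomposition through `S^q`. For `S^q`, the maps into `R` are the traces `a ↦ ∑_g g(a s_j)`.
-- Composing with the coordinates gives `t^q ↦ ∑_g g(t)^q ∑_j c_j(g s_j)^q`, so what is needed is
-- `s_j` with `∑_j c_j(g s_j)^q = δ_{g,1}`. Largeness provides them: if `S/𝔪^[q]` contains every
-- irreducible, Maschke's theorem puts `δ_1` in the span of its matrix coefficients, and homogeneity
-- lifts the resulting identity of scalars from `S/𝔪^[q]` to `S`. The statement for `End_R(S)`
-- follows because Frobenius identifies `(R, S)` with `(R^q, S^q)`.
--
-- Parts 2 and 3 share the bound `q ≥ #G`. Choose a linear form `ξ` with trivial stabiliser. A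
-- product of `#G - 1` affine-linear factors takes the value 1 at `ξ` and 0 at the other points of
-- its orbit. Its degree is below `q`, so evaluation at `ξ` still makes sense modulo `𝔪^[q]`, and
-- `δ_1` is a matrix coefficient. Orthogonality and Schur's lemma then split off each irreducible.

universe w

/-! ### Morita equivalence from mutual direct summands of finite powers -/

section Morita

variable {R : Type v} [CommRing R]
  {M N : Type u} [AddCommGroup M] [Module R M] [AddCommGroup N] [Module R N]

theorem homTensor_mk_comp_tmul {X : Type u} [AddCommGroup X] [Module (Module.End R M) X]
    (f : M →ₗ[R] N) (a : Module.End R M) (x : X) :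
    (Submodule.Quotient.mk ((f ∘ₗ a) ⊗ₜ[ℤ] x) : HomTensor R M N X) =
      Submodule.Quotient.mk (f ⊗ₜ[ℤ] (a • x)) :=
  (Submodule.Quotient.eq _).2 (Submodule.subset_span ⟨f, a, x, rfl⟩)

/-- The `End_R(N)`-linear map out of `Hom_R(M, N) ⊗_{End_R(M)} X` induced by a balanced
biadditive map. -/
noncomputable def homTensorLift {X Y : Type u} [AddCommGroup X] [Module (Module.End R M) X]
    [AddCommGroup Y] [Module (Module.End R N) Y]
    (β : (M →ₗ[R] N) →ₗ[Module.End R N] (X →+ Y))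
    (hβ : ∀ f a x, β (f ∘ₗ a) x = β f (a • x)) :
    HomTensor R M N X →ₗ[Module.End R N] Y :=
  Submodule.liftQ _
    (TensorProduct.AlgebraTensorModule.lift
      { toFun := fun f => (β f).toIntLinearMap
        map_add' := fun f g => by ext; simp
        map_smul' := fun b f => by ext; simp } : ((M →ₗ[R] N) ⊗[ℤ] X) →ₗ[Module.End R N] Y)
    (by
      refine Submodule.span_le.2 ?_
      rintro _ ⟨f, a, x, rfl⟩
      simp [hβ])

variable (R M N) in
/-- For `g : N → M`, the map `Hom_R(M, N) ⊗_{End_R(M)} X → X` sending `f ⊗ x` to `(g ∘ f) • x`. -/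
noncomputable def homTensorContract (X : Type u) [AddCommGroup X] [Module (Module.End R M) X]
    (g : N →ₗ[R] M) : HomTensor R M N X →+ X :=
  QuotientAddGroup.lift (homTensorRel R M N X).toAddSubgroup
    (TensorProduct.liftAddHom (R := ℤ) (M := M →ₗ[R] N) (N := X)
      { toFun := fun f =>
          { toFun := fun x => ((g ∘ₗ f : Module.End R M) • x : X)
            map_zero' := smul_zero _
            map_add' := smul_add _ }
        map_zero' := by ext; simp
        map_add' := fun f f' => by ext x; simp [LinearMap.comp_add, add_smul] }
      (fun n f x => by
        change (g ∘ₗ (n • f) : Module.End R M) • x = (g ∘ₗ f : Module.End R M) • (n • x)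
        rw [smul_comm (g ∘ₗ f : Module.End R M) n x, ← smul_assoc]
        congr 1
        ext; simp))
    (by
      rw [homTensorRel_toAddSubgroup, AddSubgroup.closure_le]
      rintro _ ⟨f, a, x, rfl⟩
      change (_ : X) = 0
      rw [map_sub, sub_eq_zero]
      change (g ∘ₗ (f ∘ₗ a) : Module.End R M) • x = (g ∘ₗ f : Module.End R M) • (a • x)
      rw [smul_smul]; rfl)

theorem homTensorContract_mk (X : Type u) [AddCommGroup X] [Module (Module.End R M) X]
    (g : N →ₗ[R] M) (f : M →ₗ[R] N) (x : X) :
    homTensorContract R M N X g (Submodule.Quotient.mk (f ⊗ₜ[ℤ] x)) =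
      (g ∘ₗ f : Module.End R M) • x := rfl

/-- Additive maps are needed here because contraction against a fixed `g : N → M` lands in `X`,
which carries no `End_R(N)`-action. -/
theorem homTensor_addHom_ext {X P : Type u} [AddCommGroup X] [Module (Module.End R M) X]
    [AddCommGroup P] {α β : HomTensor R M N X →+ P}
    (h : ∀ (f : M →ₗ[R] N) (x : X),
      α (Submodule.Quotient.mk (f ⊗ₜ[ℤ] x)) = β (Submodule.Quotient.mk (f ⊗ₜ[ℤ] x))) : α = β := by
  refine AddMonoidHom.ext fun t => ?_
  obtain ⟨t, rfl⟩ := Submodule.Quotient.mk_surjective _ t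
  induction t with
  | zero => rw [Submodule.Quotient.mk_zero, map_zero, map_zero]
  | add x y hx hy => rw [Submodule.Quotient.mk_add, map_add, map_add, hx, hy]
  | tmul f x => exact h f x

/-- Additive maps out of `Hom_R(N, M) ⊗ (Hom_R(M, N) ⊗ X)` agree if they agree on pure tensors. -/
theorem homTensor_homTensor_addHom_ext {X P : Type u} [AddCommGroup X]
    [Module (Module.End R M) X] [AddCommGroup P]
    {α β : HomTensor R N M (HomTensor R M N X) →+ P}
    (h : ∀ (g : N →ₗ[R] M) (f : M →ₗ[R] N) (x : X),
      α (Submodule.Quotient.mk (g ⊗ₜ[ℤ] Submodule.Quotient.mk (f ⊗ₜ[ℤ] x))) =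
        β (Submodule.Quotient.mk (g ⊗ₜ[ℤ] Submodule.Quotient.mk (f ⊗ₜ[ℤ] x)))) : α = β := by
  refine homTensor_addHom_ext fun g t => ?_
  induction t using Submodule.Quotient.induction_on with | _ t
  induction t with
  | zero => rw [Submodule.Quotient.mk_zero, TensorProduct.tmul_zero, Submodule.Quotient.mk_zero,
      map_zero, map_zero]
  | add x y hx hy => rw [Submodule.Quotient.mk_add, TensorProduct.tmul_add,
      Submodule.Quotient.mk_add, map_add, map_add, hx, hy]
  | tmul f x => exact h g f x

variable (R M N) in
/-- The evaluation `g ⊗ (f ⊗ x) ↦ (g ∘ f) • x`. -/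
noncomputable def homTensorEval (X : Type u) [AddCommGroup X] [Module (Module.End R M) X] :
    HomTensor R N M (HomTensor R M N X) →ₗ[Module.End R M] X :=
  homTensorLift
    { toFun := homTensorContract R M N X
      map_add' := fun g g' => homTensor_addHom_ext fun f x => by
        rw [AddMonoidHom.add_apply, homTensorContract_mk, homTensorContract_mk,
          homTensorContract_mk, LinearMap.add_comp, add_smul]
      map_smul' := fun b g => homTensor_addHom_ext fun f x => by
        change homTensorContract R M N X (b • g) _ = b • homTensorContract R M N X g _
        rw [homTensorContract_mk, homTensorContract_mk, smul_smul]
        rfl }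
    (fun g a t => by
      change homTensorContract R M N X (g ∘ₗ a) t =
        ((homTensorContract R M N X g).comp (DistribSMul.toAddMonoidHom _ a)) t
      refine DFunLike.congr_fun (homTensor_addHom_ext fun f x => ?_) t
      rfl)

theorem homTensorEval_mk {X : Type u} [AddCommGroup X] [Module (Module.End R M) X]
    (g : N →ₗ[R] M) (f : M →ₗ[R] N) (x : X) :
    homTensorEval R M N X
        (Submodule.Quotient.mk (g ⊗ₜ[ℤ] (Submodule.Quotient.mk (f ⊗ₜ[ℤ] x)))) =
      (g ∘ₗ f : Module.End R M) • x := rfl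

/-- Naturality of evaluation: `φ` commutes with the action of `g ∘ f ∈ End_R(M)`. -/
theorem homTensorEval_homTensorMap {X Y : Type u} [AddCommGroup X] [Module (Module.End R M) X]
    [AddCommGroup Y] [Module (Module.End R M) Y] (φ : X →ₗ[Module.End R M] Y)
    (t : HomTensor R N M (HomTensor R M N X)) :
    homTensorEval R M N Y (homTensorMap R N M (homTensorMap R M N φ) t) =
      φ (homTensorEval R M N X t) := by
  suffices h : ((homTensorEval R M N Y).comp
      (homTensorMap R N M (homTensorMap R M N φ))).toAddMonoidHom =
      (φ.comp (homTensorEval R M N X)).toAddMonoidHom from DFunLike.congr_fun h t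
  exact homTensor_homTensor_addHom_ext fun g f x => (φ.map_smul (g ∘ₗ f : Module.End R M) x).symm

section

variable {J : Type*} [Fintype J] (f : J → (M →ₗ[R] N)) (g : J → (N →ₗ[R] M))

theorem sum_comp_eq_one (h : ∀ x, ∑ j, g j (f j x) = x) :
    ∑ j, (g j ∘ₗ f j : Module.End R M) = 1 := by
  ext x
  simp [h]

/-- The map `x ↦ ∑ g_j ⊗ (f_j ⊗ x)` is a left inverse of evaluation. In `g_j ⊗ (f_j ⊗ (g' f') x)`,
the factor `g' f'` slides left across both tensor signs, giving `(g_j f_j) • (g' ⊗ (f' ⊗ x))`, and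
`∑ g_j f_j = 1`. -/
theorem sum_tmul_tmul_homTensorEval (h : ∀ x, ∑ j, g j (f j x) = x) {X : Type u}
    [AddCommGroup X] [Module (Module.End R M) X] (t : HomTensor R N M (HomTensor R M N X)) :
    ∑ j, (Submodule.Quotient.mk (g j ⊗ₜ[ℤ] (Submodule.Quotient.mk
      (f j ⊗ₜ[ℤ] homTensorEval R M N X t))) : HomTensor R N M (HomTensor R M N X)) = t := by
  let u : X →+ HomTensor R N M (HomTensor R M N X) :=
    { toFun := fun x => ∑ j, Submodule.Quotient.mk (g j ⊗ₜ[ℤ] (Submodule.Quotient.mk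
        (f j ⊗ₜ[ℤ] x)))
      map_zero' := by simp
      map_add' := fun x y => by
        simp only [TensorProduct.tmul_add, Submodule.Quotient.mk_add, Finset.sum_add_distrib] }
  suffices hu : u.comp (homTensorEval R M N X).toAddMonoidHom = AddMonoidHom.id _ from
    DFunLike.congr_fun hu t
  refine homTensor_homTensor_addHom_ext fun g' f' x => ?_
  change ∑ j, (Submodule.Quotient.mk (g j ⊗ₜ[ℤ] (Submodule.Quotient.mk
      (f j ⊗ₜ[ℤ] ((g' ∘ₗ f' : Module.End R M) • x)))) :
        HomTensor R N M (HomTensor R M N X)) = Submodule.Quotient.mk _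
  have key : ∀ j, (Submodule.Quotient.mk (g j ⊗ₜ[ℤ] (Submodule.Quotient.mk
      (f j ⊗ₜ[ℤ] ((g' ∘ₗ f' : Module.End R M) • x)))) :
        HomTensor R N M (HomTensor R M N X)) =
      (g j ∘ₗ f j : Module.End R M) • Submodule.Quotient.mk
        (g' ⊗ₜ[ℤ] (Submodule.Quotient.mk (f' ⊗ₜ[ℤ] x))) := by
    intro j
    rw [← homTensor_mk_comp_tmul, ← LinearMap.comp_assoc]
    change Submodule.Quotient.mk (g j ⊗ₜ[ℤ] ((f j ∘ₗ g' : Module.End R N) •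
      (Submodule.Quotient.mk (f' ⊗ₜ[ℤ] x) : HomTensor R M N X))) = _
    rw [← homTensor_mk_comp_tmul]
    rfl
  rw [Finset.sum_congr rfl fun j _ => key j, ← Finset.sum_smul, sum_comp_eq_one f g h, one_smul]

/-- If `id_M` is a sum of endomorphisms factoring through `N`, then evaluation is an
isomorphism. -/
theorem homTensorEval_bijective (h : ∀ x, ∑ j, g j (f j x) = x) (X : Type u)
    [AddCommGroup X] [Module (Module.End R M) X] :
    Function.Bijective (homTensorEval R M N X) := by
  refine ⟨Function.LeftInverse.injective (g := fun x => ∑ j, Submodule.Quotient.mk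
    (g j ⊗ₜ[ℤ] (Submodule.Quotient.mk (f j ⊗ₜ[ℤ] x)))) (sum_tmul_tmul_homTensorEval f g h), fun x =>
    ⟨∑ j, Submodule.Quotient.mk (g j ⊗ₜ[ℤ] (Submodule.Quotient.mk (f j ⊗ₜ[ℤ] x))), ?_⟩⟩
  rw [map_sum]
  simp only [homTensorEval_mk]
  rw [← Finset.sum_smul, sum_comp_eq_one f g h, one_smul]

/-- If `id_M` is a sum of endomorphisms factoring through `N`, then
`Hom_R(N, M) ⊗ (Hom_R(M, N) ⊗ -)` is naturally isomorphic to the identity functor. -/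
noncomputable def homTensorFunctorCompIso (h : ∀ x, ∑ j, g j (f j x) = x) :
    homTensorFunctor R M N ⋙ homTensorFunctor R N M ≅ 𝟭 (ModuleCat.{u} (Module.End R M)) :=
  NatIso.ofComponents
    (fun X => (LinearEquiv.ofBijective (homTensorEval R M N X)
      (homTensorEval_bijective f g h X)).toModuleIso)
    (fun φ => ModuleCat.hom_ext (LinearMap.ext fun t => homTensorEval_homTensorMap φ.hom t))

end

-- A scalar of `R` commutes with every `f : M → N`, so it passes from the right tensor factor to the
-- left one.
open scoped ModuleCat.Algebra in
theorem homTensorFunctor_linear : Functor.Linear R (homTensorFunctor R M N) where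
  map_smul {X Y} φ r := by
    apply ModuleCat.hom_ext
    refine homTensor_hom_ext R M N fun f x => ?_
    change Submodule.Quotient.mk (f ⊗ₜ[ℤ] (algebraMap R (Module.End R M) r • φ.hom x)) =
      algebraMap R (Module.End R N) r •
        (Submodule.Quotient.mk (f ⊗ₜ[ℤ] φ.hom x) : HomTensor R M N Y)
    rw [← homTensor_mk_comp_tmul, ← Submodule.Quotient.mk_smul, TensorProduct.smul_tmul']
    congr 2
    ext m
    simp

/-- Modules `M` and `N` each of which is a direct summand of a finite power of the other have
Morita equivalent endomorphism rings, via the functors `Hom_R(M, N) ⊗ -` and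
`Hom_R(N, M) ⊗ -`. -/
theorem exists_moritaEquivalence_homTensorFunctor {J J' : Type*} [Fintype J] [Fintype J']
    (f : J → (M →ₗ[R] N)) (g : J → (N →ₗ[R] M)) (h : ∀ x, ∑ j, g j (f j x) = x)
    (f' : J' → (N →ₗ[R] M)) (g' : J' → (M →ₗ[R] N)) (h' : ∀ x, ∑ j, g' j (f' j x) = x) :
    ∃ E : MoritaEquivalence R (Module.End R M) (Module.End R N),
      E.eqv.functor = homTensorFunctor R M N ∧ E.eqv.inverse = homTensorFunctor R N M :=
  ⟨{ eqv := CategoryTheory.Equivalence.mk (homTensorFunctor R M N) (homTensorFunctor R N M)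
      (homTensorFunctorCompIso f g h).symm (homTensorFunctorCompIso f' g' h')
     linear := homTensorFunctor_linear }, rfl, rfl⟩

end Morita

/-! ### Matrix coefficients and irreducible summands -/

section MatrixCoefficients

open scoped MonoidAlgebra

/-- A `k[G]`-module that is finite-dimensional over `k` is isomorphic to one coming from a
representation on a coordinate space. -/
theorem exists_representation_fin_equiv {k : Type u} [Field k] {G : Type v} [Group G] {M : Type w}
    [AddCommGroup M] [Module k M] [Module k[G] M] [IsScalarTower k k[G] M]
    [FiniteDimensional k M] :
    ∃ (n : ℕ) (ρ : Representation k G (Fin n → k)) (e : M ≃ₗ[k] (Fin n → k)),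
      (∀ g m, e (MonoidAlgebra.single g (1 : k) • m) = ρ g (e m)) ∧
      Nonempty (ρ.asModule ≃ₗ[k[G]] M) := by
  let e : M ≃ₗ[k] (Fin (Module.finrank k M) → k) :=
    (Module.finBasis k M).equivFun
  let ρ₀ : Representation k G M :=
    ((Algebra.lsmul k k M : k[G] →ₐ[k] Module.End k M) : k[G] →* Module.End k M).comp
      (MonoidAlgebra.of k G)
  let ρ : Representation k G (Fin (Module.finrank k M) → k) :=
    (e.conjRingEquiv : Module.End k M →* _).comp ρ₀
  have hρ : ∀ g m, ρ g m = e (MonoidAlgebra.single g (1 : k) • e.symm m) := fun g m => rfl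
  refine ⟨_, ρ, e, fun g m => by rw [hρ, e.symm_apply_apply], ⟨?_⟩⟩
  refine { (ρ.asModuleEquiv.toAddEquiv.trans e.symm.toAddEquiv) with map_smul' := ?_ }
  intro x m
  change e.symm (ρ.asModuleEquiv (x • m)) = x • e.symm (ρ.asModuleEquiv m)
  induction x using MonoidAlgebra.induction_linear with
  | zero => simp
  | add x y hx hy => simp only [add_smul, map_add, hx, hy]
  | single g a =>
    rw [Representation.asModuleEquiv_map_smul, Representation.asAlgebraHom_single,
      LinearMap.smul_apply, hρ, map_smul, e.symm_apply_apply, ← smul_assoc,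
      MonoidAlgebra.smul_single, smul_eq_mul, mul_one]

/-- If `τ` contains every irreducible representation of `G` and `#G` is invertible, then the
delta function at `1` is a linear combination of matrix coefficients of `τ`. -/
theorem single_one_mem_span_matrixCoeff {k : Type u} [Field k] {G : Type v} [Group G] [Finite G]
    [DecidableEq G] (tame : (Nat.card G : k) ≠ 0) {W : Type w} [AddCommGroup W] [Module k W]
    (τ : Representation k G W)
    (h : ∀ (U : Type u) [AddCommGroup U] [Module k U] [FiniteDimensional k U]
      (ρ : Representation k G U), ρ.IsIrreducible →
      ∃ i : ρ.IntertwiningMap τ, Function.Injective i) :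
    (Pi.single 1 1 : G → k) ∈
      Submodule.span k {φ | ∃ (l : Module.Dual k W) (w : W), φ = fun g => l (τ g w)} := by
  have := Fintype.ofFinite G
  have : NeZero (Nat.card G : k) := ⟨tame⟩
  by_contra hns
  obtain ⟨f, hf, hle⟩ := Submodule.exists_le_ker_of_notMem hns
  -- The functional `f` on functions `G → k`, read as an element of the group algebra. That `f`
  -- kills all matrix coefficients means that `x` acts as zero on `τ`.
  let x : k[G] := ∑ g, MonoidAlgebra.single g (f (Pi.single g 1))
  have hτ : ∀ w, ∑ g, f (Pi.single g 1) • τ g w = 0 := by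
    intro w
    refine (Module.forall_dual_apply_eq_zero_iff k _).1 fun l => ?_
    have h1 : f (fun g => l (τ g w)) = 0 :=
      hle (Submodule.subset_span ⟨l, w, rfl⟩)
    rw [← h1, pi_eq_sum_univ' (fun g => l (τ g w)), map_sum, map_sum]
    refine Finset.sum_congr rfl fun g _ => ?_
    rw [map_smul, map_smul, smul_eq_mul, smul_eq_mul, mul_comm]
  -- Acting as zero on `τ`, `x` acts as zero on every simple module `k[G]/I`, so it lies in every
  -- maximal left ideal; by Maschke the Jacobson radical vanishes.
  have hx : x = 0 := by
    have hJ : Ring.jacobson k[G] = ⊥ := IsSemisimpleModule.jacobson_eq_bot _ _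
    rw [← Submodule.mem_bot (R := k[G]), ← hJ, Ring.jacobson_eq_sInf_isMaximal, Submodule.mem_sInf]
    intro I hI
    have hI' : Ideal.IsMaximal I := hI
    have : IsSimpleModule k[G] (k[G] ⧸ I) := isSimpleModule_iff_isCoatom.2 hI'.out
    have : FiniteDimensional k (k[G] ⧸ I) := inferInstance
    -- The hypothesis `h` covers only representations in the universe of `k`, so the quotient is
    -- moved to a coordinate space.
    obtain ⟨n, ρ, e, he, ⟨E⟩⟩ :=
      exists_representation_fin_equiv (k := k) (G := G) (M := k[G] ⧸ I)
    obtain ⟨i, hi⟩ := h (Fin n → k) ρ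
      ((Representation.irreducible_iff_isSimpleModule_asModule ρ).2 (IsSimpleModule.congr E))
    rw [← Submodule.Quotient.mk_eq_zero, ← mul_one x, ← smul_eq_mul, Submodule.Quotient.mk_smul]
    apply e.injective
    apply hi
    rw [map_zero, map_zero, Finset.sum_smul, map_sum, map_sum,
      ← hτ (i (e (Submodule.Quotient.mk 1)))]
    refine Finset.sum_congr rfl fun g _ => ?_
    rw [← i.isIntertwining, ← he, ← map_smul, ← map_smul, ← smul_assoc, MonoidAlgebra.smul_single,
      smul_eq_mul, mul_one]
  apply hf
  have := congrArg (fun y : k[G] => y.coeff 1) hx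
  simpa [x, Finsupp.single_apply] using this

/-- If the delta function at `1` is a matrix coefficient of `τ` and `#G` is invertible, then `τ`
contains every irreducible representation of `G` as a direct summand. -/
theorem exists_retraction_of_matrixCoeff_eq_single {k : Type u} [Field k] {G : Type v} [Group G]
    [Finite G] [DecidableEq G] (tame : (Nat.card G : k) ≠ 0) {W : Type w} [AddCommGroup W]
    [Module k W] (τ : Representation k G W) (l : Module.Dual k W) (w : W)
    (hlw : ∀ g, l (τ g w) = if g = 1 then 1 else 0)
    {U : Type*} [AddCommGroup U] [Module k U] [FiniteDimensional k U]
    (ρ : Representation k G U) (hρ : ρ.IsIrreducible) :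
    ∃ (i : ρ.IntertwiningMap τ) (r : τ.IntertwiningMap ρ), ∀ x, r (i x) = x := by
  have := Fintype.ofFinite G
  let i (ξ : Module.Dual k U) : ρ.IntertwiningMap τ :=
    { toLinearMap := ∑ g, (ξ ∘ₗ ρ g⁻¹).smulRight (τ g w)
      isIntertwining' := fun h => by
        ext u
        simp only [LinearMap.comp_apply, LinearMap.sum_apply, LinearMap.smulRight_apply, map_sum,
          map_smul]
        refine Fintype.sum_equiv (Equiv.mulLeft h⁻¹) _ _ fun g => ?_
        simp [← Module.End.mul_apply, ← map_mul] }
  let r (u₀ : U) : τ.IntertwiningMap ρ :=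
    { toLinearMap := ∑ g, (l ∘ₗ τ g⁻¹).smulRight (ρ g u₀)
      isIntertwining' := fun h => by
        ext u
        simp only [LinearMap.comp_apply, LinearMap.sum_apply, LinearMap.smulRight_apply, map_sum,
          map_smul]
        refine Fintype.sum_equiv (Equiv.mulLeft h⁻¹) _ _ fun g => ?_
        simp [← Module.End.mul_apply, ← map_mul] }
  -- In the double sum over `g, h`, the coefficient `l (τ (g⁻¹ h) w)` leaves only the terms with `h
  -- = g`.
  have hri : ∀ ξ u₀ u, r u₀ (i ξ u) = ∑ g, ξ (ρ g⁻¹ u) • ρ g u₀ := by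
    intro ξ u₀ u
    have h1 : r u₀ (i ξ u) = ∑ g, l (τ g⁻¹ (∑ h, ξ (ρ h⁻¹ u) • τ h w)) • ρ g u₀ := by
      simp only [r, i, ← Representation.IntertwiningMap.toLinearMap_apply, LinearMap.sum_apply,
        LinearMap.smulRight_apply, LinearMap.comp_apply]
    rw [h1]
    refine Finset.sum_congr rfl fun g _ => ?_
    congr 1
    simp only [map_sum, map_smul, ← Module.End.mul_apply, ← map_mul, hlw, smul_eq_mul, mul_ite,
      mul_one, mul_zero]
    simp [inv_mul_eq_one]
  obtain ⟨ξ, u₀, hne⟩ : ∃ ξ u₀, (r u₀).comp (i ξ) ≠ 0 := by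
    by_contra! hall
    obtain ⟨u, hu⟩ : ∃ u : U, u ≠ 0 := by
      by_contra! h0
      have : Subsingleton U := ⟨fun a b => by rw [h0 a, h0 b]⟩
      have : Subsingleton (Subrepresentation ρ) :=
        Subrepresentation.toSubmodule_injective.subsingleton
      exact not_subsingleton (Subrepresentation ρ) this
    let b := Module.finBasis k U
    -- Over a basis and its dual, each `g` contributes `ρ g (ρ g⁻¹ u) = u`, so the composites add up
    -- to multiplication by `#G ≠ 0` and cannot all vanish.
    have h2 : ∑ j, r (b j) (i (b.coord j) u) = (Nat.card G : k) • u := by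
      simp only [hri]
      rw [Finset.sum_comm]
      have : ∀ g, ∑ j, b.coord j (ρ g⁻¹ u) • ρ g (b j) = u := by
        intro g
        have h3 : ρ g (ρ g⁻¹ u) = u := by simp [← Module.End.mul_apply, ← map_mul]
        conv_rhs => rw [← h3, ← b.sum_repr (ρ g⁻¹ u)]
        simp only [map_sum, map_smul, Module.Basis.coord_apply]
      rw [Finset.sum_congr rfl fun g _ => this g]
      simp [Nat.cast_smul_eq_nsmul]
    have h4 : ∀ j, r (b j) (i (b.coord j) u) = 0 := fun j =>
      DFunLike.congr_fun (hall (b.coord j) (b j)) u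
    rw [Finset.sum_eq_zero fun j _ => h4 j] at h2
    exact (smul_ne_zero tame hu) h2.symm
  -- Schur's lemma: a nonzero endomorphism of an irreducible is invertible, and composing `r` with
  -- its inverse gives a retraction of `i`.
  have hbij := (Representation.IsIrreducible.bijective_or_eq_zero ((r u₀).comp (i ξ))).resolve_right
    hne
  let E := Representation.IntertwiningMap.ofBijective _ hbij
  exact ⟨i ξ, E.symm.toIntertwiningMap.comp (r u₀), fun x => E.symm_apply_apply x⟩

end MatrixCoefficients

/-! ### Coordinates of a polynomial ring over its `q`-th powers -/

namespace MvPolynomial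

variable {k : Type u} [Field k] (p e : ℕ) [Fact p.Prime] [CharP k p] [PerfectRing k p]
  {σ : Type w}

open Classical in
/-- The coordinate of `f` at `X ^ j` with respect to the monomial basis of `k[X]` over
`k[X] ^ q`, where `q = p ^ e`, followed by extraction of `q`-th roots. -/
noncomputable def frobeniusCoord (j : σ →₀ ℕ) : MvPolynomial σ k →+ MvPolynomial σ k :=
  (Finsupp.liftAddHom fun m : σ →₀ ℕ =>
    if m.mapRange (· % p ^ e) (Nat.zero_mod _) = j then
      (monomial (R := k) (m.mapRange (· / p ^ e) (Nat.zero_div _))).toAddMonoidHom.comp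
        (iterateFrobeniusEquiv k p e).symm.toAddEquiv.toAddMonoidHom
    else 0).comp AddMonoidAlgebra.coeffAddEquiv.toAddMonoidHom

open Classical in
theorem frobeniusCoord_monomial (j m : σ →₀ ℕ) (a : k) :
    frobeniusCoord p e j (monomial m a) =
      if m.mapRange (· % p ^ e) (Nat.zero_mod _) = j then
        monomial (m.mapRange (· / p ^ e) (Nat.zero_div _)) ((iterateFrobeniusEquiv k p e).symm a)
      else 0 := by
  have : frobeniusCoord p e j (monomial m a) = _ :=
    Finsupp.liftAddHom_apply_single _ m a
  rw [this]
  split_ifs <;> rfl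

theorem frobeniusCoord_pow_mul (j : σ →₀ ℕ) (t f : MvPolynomial σ k) :
    frobeniusCoord p e j (t ^ p ^ e * f) = t * frobeniusCoord p e j f := by
  have hq : 0 < p ^ e := pow_pos (Fact.out : p.Prime).pos e
  induction t using MvPolynomial.induction_on' with
  | add t t' ht ht' => rw [add_pow_char_pow, add_mul, map_add, ht, ht', add_mul]
  | monomial n b =>
    induction f using MvPolynomial.induction_on' with
    | add f f' hf hf' => rw [mul_add, map_add, hf, hf', map_add, mul_add]
    | monomial m a =>
      rw [monomial_pow, monomial_mul, frobeniusCoord_monomial, frobeniusCoord_monomial]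
      have h1 : (p ^ e • n + m).mapRange (· % p ^ e) (Nat.zero_mod _) =
          m.mapRange (· % p ^ e) (Nat.zero_mod _) := by
        ext i; simp
      have h2 : (p ^ e • n + m).mapRange (· / p ^ e) (Nat.zero_div _) =
          n + m.mapRange (· / p ^ e) (Nat.zero_div _) := by
        ext i; simp [Nat.mul_add_div hq]
      rw [h1, h2, map_mul, ← iterateFrobeniusEquiv_def, RingEquiv.symm_apply_apply, mul_ite,
        mul_zero, monomial_mul]

variable [Finite σ]

/-- The exponents with all entries smaller than `q`. -/
noncomputable def reducedExponent {q : ℕ} (j : σ → Fin q) : σ →₀ ℕ :=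
  Finsupp.equivFunOnFinite.symm fun i => j i

theorem reducedExponent_apply {q : ℕ} (j : σ → Fin q) (i : σ) : reducedExponent j i = j i := rfl

theorem mapRange_mod_eq_reducedExponent_iff {q : ℕ} [NeZero q] (m : σ →₀ ℕ) (j : σ → Fin q) :
    m.mapRange (· % q) (Nat.zero_mod _) = reducedExponent j ↔ j = fun i => Fin.ofNat q (m i) := by
  rw [Finsupp.ext_iff, _root_.funext_iff]
  refine forall_congr' fun i => ?_
  rw [Fin.ext_iff, reducedExponent_apply, Finsupp.mapRange_apply, Fin.val_ofNat, eq_comm]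

/-- Division with remainder of exponents, `X^m = (X^(m / q))^q X^(m % q)`, with `q`-th roots of
coefficients available because `k` is perfect. -/
theorem sum_frobeniusCoord_pow_mul [Fintype (σ → Fin (p ^ e))] (f : MvPolynomial σ k) :
    ∑ j : σ → Fin (p ^ e), frobeniusCoord p e (reducedExponent j) f ^ p ^ e *
      monomial (reducedExponent j) 1 = f := by
  classical
  have : NeZero (p ^ e) := ⟨(pow_pos (Fact.out : p.Prime).pos e).ne'⟩
  induction f using MvPolynomial.induction_on' with
  | add f f' hf hf' =>
    conv_rhs => rw [← hf, ← hf']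
    rw [← Finset.sum_add_distrib]
    refine Finset.sum_congr rfl fun j _ => ?_
    rw [map_add, add_pow_char_pow, add_mul]
  | monomial m a =>
    rw [Finset.sum_eq_single (fun i => Fin.ofNat (p ^ e) (m i))]
    · rw [frobeniusCoord_monomial, if_pos ((mapRange_mod_eq_reducedExponent_iff m _).2 rfl),
        monomial_pow, monomial_mul, ← iterateFrobeniusEquiv_def, RingEquiv.apply_symm_apply, mul_one]
      refine congrArg (monomial · a) (Finsupp.ext fun i => ?_)
      simp [reducedExponent_apply, Nat.div_add_mod]
    · intro j _ hj
      rw [frobeniusCoord_monomial, if_neg (mt (mapRange_mod_eq_reducedExponent_iff m _).1 hj),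
        zero_pow NeZero.out, zero_mul]
    · exact fun h => absurd (Finset.mem_univ _) h

theorem eq_reducedExponent_iff {q : ℕ} [NeZero q] (m : σ →₀ ℕ) (j : σ → Fin q) :
    m = reducedExponent j ↔ m.mapRange (· % q) (Nat.zero_mod _) = reducedExponent j ∧
      m.mapRange (· / q) (Nat.zero_div _) = 0 := by
  constructor
  · rintro rfl
    constructor <;> ext i
    · simp [reducedExponent_apply, Nat.mod_eq_of_lt (j i).2]
    · simp [reducedExponent_apply, Nat.div_eq_of_lt (j i).2]
  · rintro ⟨h1, h2⟩
    ext i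
    have h3 := DFunLike.congr_fun h1 i
    have h4 := DFunLike.congr_fun h2 i
    simp only [Finsupp.mapRange_apply, Finsupp.coe_zero, Pi.zero_apply] at h3 h4
    rw [← h3, ← Nat.div_add_mod (m i) q, h4]
    simp

/-- Only the monomial `X^j` itself has exponent residue `j` and quotient 0. -/
theorem coeff_zero_frobeniusCoord (j : σ → Fin (p ^ e)) (f : MvPolynomial σ k) :
    coeff 0 (frobeniusCoord p e (reducedExponent j) f) =
      (iterateFrobeniusEquiv k p e).symm (coeff (reducedExponent j) f) := by
  classical
  have : NeZero (p ^ e) := ⟨(pow_pos (Fact.out : p.Prime).pos e).ne'⟩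
  induction f using MvPolynomial.induction_on' with
  | add f f' hf hf' => rw [map_add, coeff_add, hf, hf', coeff_add, map_add]
  | monomial m a =>
    rw [frobeniusCoord_monomial, coeff_monomial]
    by_cases h1 : m.mapRange (· % p ^ e) (Nat.zero_mod _) = reducedExponent j
    · rw [if_pos h1, coeff_monomial]
      by_cases h2 : m.mapRange (· / p ^ e) (Nat.zero_div _) = 0
      · rw [if_pos h2, if_pos ((eq_reducedExponent_iff m j).2 ⟨h1, h2⟩)]
      · rw [if_neg h2, if_neg fun h => h2 ((eq_reducedExponent_iff m j).1 h).2, map_zero]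
    · rw [if_neg h1, if_neg fun h => h1 ((eq_reducedExponent_iff m j).1 h).1, map_zero, coeff_zero]

/-- An exponent with residue `j` modulo `q` dominates `j`; having the same degree, it equals `j`.
Hence the coordinate has no nonconstant term, which later allows an identity modulo `𝔪^[q]` to be
lifted exactly. -/
theorem frobeniusCoord_of_isHomogeneous (j : σ → Fin (p ^ e)) {f : MvPolynomial σ k}
    (hf : f.IsHomogeneous (reducedExponent j).degree) :
    frobeniusCoord p e (reducedExponent j) f =
      C ((iterateFrobeniusEquiv k p e).symm (coeff (reducedExponent j) f)) := by
  classical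
  have : NeZero (p ^ e) := ⟨(pow_pos (Fact.out : p.Prime).pos e).ne'⟩
  suffices h : ∀ n ≠ 0, coeff n (frobeniusCoord p e (reducedExponent j) f) = 0 by
    ext n
    rw [coeff_C]
    split_ifs with hn
    · rw [← hn, coeff_zero_frobeniusCoord]
    · exact h n (Ne.symm hn)
  intro n hn
  conv_lhs => rw [← support_sum_monomial_coeff f]
  rw [map_sum, coeff_sum]
  refine Finset.sum_eq_zero fun m hm => ?_
  rw [frobeniusCoord_monomial]
  split_ifs with h1
  · rw [coeff_monomial, if_neg]
    rintro rfl
    apply hn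
    have hdeg : m.degree = (reducedExponent j).degree := by
      have h3 := hf (mem_support_iff.1 hm)
      have h4 := DFunLike.congr_fun (Finsupp.degree_eq_weight_one (σ := σ) (R := ℕ)) m
      exact h4.trans h3
    have hle : reducedExponent j ≤ m := fun i => by
      rw [← h1]; exact Nat.mod_le _ _
    obtain ⟨c, hc⟩ := exists_add_of_le hle
    have hc0 : c = 0 := by
      rw [hc, map_add] at hdeg
      exact (Finsupp.degree_eq_zero_iff c).1 (by omega)
    rw [hc0, add_zero] at hc
    exact ((eq_reducedExponent_iff m j).1 hc).2
  · exact coeff_zero _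

end MvPolynomial

/-! ### The grading on `Sym(V)`, and Frobenius coordinates transported to it -/

namespace SymmetricAlgebra

variable {k : Type u} [Field k] {V : Type v} [AddCommGroup V] [Module k V]
  {σ : Type w} (b : Module.Basis σ k V)

theorem equivMvPolynomial_ι_isHomogeneous (x : V) :
    (equivMvPolynomial b (ι k V x)).IsHomogeneous 1 := by
  have h : Submodule.span k (Set.range b) ≤ (MvPolynomial.homogeneousSubmodule σ k 1).comap
      ((equivMvPolynomial b).toLinearMap ∘ₗ ι k V) := by
    refine Submodule.span_le.2 ?_
    rintro _ ⟨i, rfl⟩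
    change (equivMvPolynomial b (ι k V (b i))).IsHomogeneous 1
    rw [equivMvPolynomial_ι_apply]
    exact MvPolynomial.isHomogeneous_X _ _
  exact h (b.mem_span x)

theorem equivMvPolynomial_symAct (g : V ≃ₗ[k] V) (s : SymmetricAlgebra k V) :
    equivMvPolynomial b (symAct g s) =
      MvPolynomial.aeval (fun i => equivMvPolynomial b (ι k V (g (b i))))
        (equivMvPolynomial b s) := by
  have h : ((equivMvPolynomial b : _ →ₐ[k] MvPolynomial σ k).comp (symAct g)).comp
      ((equivMvPolynomial b).symm : _ →ₐ[k] _) =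
      MvPolynomial.aeval (fun i => equivMvPolynomial b (ι k V (g (b i)))) := by
    apply MvPolynomial.algHom_ext
    intro i
    simp [symAct]
  rw [← h]
  simp

/-- The homogeneous component of degree `n` of an element of the symmetric algebra. -/
noncomputable def gradedComponent (n : ℕ) : SymmetricAlgebra k V →ₗ[k] SymmetricAlgebra k V :=
  ((equivMvPolynomial b).symm.toLinearMap ∘ₗ MvPolynomial.homogeneousComponent n) ∘ₗ
    (equivMvPolynomial b).toLinearMap

theorem equivMvPolynomial_gradedComponent (n : ℕ) (s : SymmetricAlgebra k V) :
    equivMvPolynomial b (gradedComponent b n s) =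
      MvPolynomial.homogeneousComponent n (equivMvPolynomial b s) := by
  simp [gradedComponent]

/-- The action is a linear substitution of variables, so it preserves degree. -/
theorem gradedComponent_symAct (g : V ≃ₗ[k] V) (n : ℕ) (s : SymmetricAlgebra k V) :
    gradedComponent b n (symAct g s) = symAct g (gradedComponent b n s) := by
  apply (equivMvPolynomial b).injective
  rw [equivMvPolynomial_gradedComponent, equivMvPolynomial_symAct, equivMvPolynomial_symAct,
    equivMvPolynomial_gradedComponent]
  set f := equivMvPolynomial b s
  have hh : ∀ m, (MvPolynomial.aeval (fun i => equivMvPolynomial b (ι k V (g (b i))))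
      (MvPolynomial.homogeneousComponent m f)).IsHomogeneous m := fun m => by
    have := (MvPolynomial.homogeneousComponent_isHomogeneous m f).aeval _
      (fun i => equivMvPolynomial_ι_isHomogeneous b (g (b i)))
    rwa [one_mul] at this
  conv_lhs => rw [← MvPolynomial.sum_homogeneousComponent f]
  rw [map_sum, map_sum, Finset.sum_congr rfl fun m _ =>
    MvPolynomial.homogeneousComponent_of_mem (m := n) (hh m)]
  rw [Finset.sum_ite_eq]
  split_ifs with h
  · rfl
  · rw [MvPolynomial.homogeneousComponent_eq_zero _ _ (by simpa using h), map_zero]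

theorem mem_symMaxIdeal_iff (s : SymmetricAlgebra k V) :
    s ∈ symMaxIdeal k V ↔ equivMvPolynomial b s ∈ MvPolynomial.idealOfVars σ k := by
  constructor
  · intro hs
    have : symMaxIdeal k V ≤ (MvPolynomial.idealOfVars σ k).comap (equivMvPolynomial b) := by
      refine Ideal.span_le.2 ?_
      rintro _ ⟨x, rfl⟩
      change equivMvPolynomial b (ι k V x) ∈ MvPolynomial.idealOfVars σ k
      rw [← pow_one (MvPolynomial.idealOfVars σ k), MvPolynomial.mem_pow_idealOfVars_iff]
      intro m hm
      have := equivMvPolynomial_ι_isHomogeneous b x (MvPolynomial.mem_support_iff.1 hm)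
      rw [Finsupp.degree_eq_weight_one]
      exact this.ge
    exact this hs
  · intro hs
    have : MvPolynomial.idealOfVars σ k ≤ (symMaxIdeal k V).comap (equivMvPolynomial b).symm := by
      refine Ideal.span_le.2 ?_
      rintro _ ⟨i, rfl⟩
      change (equivMvPolynomial b).symm (MvPolynomial.X i) ∈ symMaxIdeal k V
      rw [equivMvPolynomial_symm_X]
      exact Ideal.subset_span ⟨_, rfl⟩
    simpa using this hs

/-- Because `𝔪^[q] ⊆ 𝔪^q`, elements of `𝔪^[q]` have no terms of degree below `q`. -/
theorem gradedComponent_eq_zero_of_mem_symFrobPower (p e : ℕ) {n : ℕ} (hn : n < p ^ e)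
    {s : SymmetricAlgebra k V} (hs : s ∈ symFrobPower k V p e) : gradedComponent b n s = 0 := by
  have hle : symFrobPower k V p e ≤
      (MvPolynomial.idealOfVars σ k ^ p ^ e).comap (equivMvPolynomial b) := by
    refine Ideal.span_le.2 ?_
    rintro _ ⟨f, hf, rfl⟩
    change equivMvPolynomial b (f ^ p ^ e) ∈ MvPolynomial.idealOfVars σ k ^ p ^ e
    rw [map_pow]
    exact Ideal.pow_mem_pow ((mem_symMaxIdeal_iff b f).1 hf) _
  apply (equivMvPolynomial b).injective
  rw [equivMvPolynomial_gradedComponent, map_zero]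
  apply MvPolynomial.homogeneousComponent_eq_zero'
  intro m hm hmn
  have := (MvPolynomial.mem_pow_idealOfVars_iff _ _).1 (hle hs) m hm
  omega

theorem sum_gradedComponent (N : ℕ) (s : SymmetricAlgebra k V)
    (hs : (equivMvPolynomial b s).totalDegree < N) :
    ∑ n ∈ Finset.range N, gradedComponent b n s = s := by
  apply (equivMvPolynomial b).injective
  rw [map_sum]
  simp only [equivMvPolynomial_gradedComponent]
  conv_rhs => rw [← MvPolynomial.sum_homogeneousComponent (equivMvPolynomial b s)]
  symm
  apply Finset.sum_subset
  · intro m hm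
    simp only [Finset.mem_range] at hm ⊢
    omega
  · intro m _ hm
    exact MvPolynomial.homogeneousComponent_eq_zero _ _ (by simpa using hm)

end SymmetricAlgebra

/-- Coordinates on `S = Sym(V)` over `S^q`: a finite basis `b` of `S` over `S^q`, whose coordinate
functions are the `q`-th powers of the additive maps `c j`, together with projections `π j` to
graded pieces on which the coordinate `c j` is a `q`-th root of the scalar `ℓ j`. -/
theorem exists_frobenius_coordinates {k : Type u} [Field k] (p e : ℕ) [Fact p.Prime] [CharP k p]
    [PerfectRing k p] (V : Type v) [AddCommGroup V] [Module k V] [FiniteDimensional k V] :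
    ∃ (J : Type) (_ : Fintype J) (b : J → SymmetricAlgebra k V)
      (c : J → SymmetricAlgebra k V →+ SymmetricAlgebra k V)
      (ℓ : J → SymmetricAlgebra k V →ₗ[k] k)
      (π : J → SymmetricAlgebra k V →ₗ[k] SymmetricAlgebra k V),
      (∀ j t s, c j (t ^ p ^ e * s) = t * c j s) ∧
      (∀ s, ∑ j, c j s ^ p ^ e * b j = s) ∧
      (∀ j g s, π j (symAct g s) = symAct g (π j s)) ∧
      (∀ j s, c j (π j s) ^ p ^ e = algebraMap k _ (ℓ j s)) ∧
      (∀ s, Ideal.Quotient.mk (symFrobPower k V p e) s =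
        ∑ j, ℓ j s • Ideal.Quotient.mk (symFrobPower k V p e) (b j)) := by
  classical
  let B := Module.finBasis k V
  let Φ := SymmetricAlgebra.equivMvPolynomial B
  let red (j : Fin (Module.finrank k V) → Fin (p ^ e)) := MvPolynomial.reducedExponent j
  let c (j : Fin (Module.finrank k V) → Fin (p ^ e)) :
      SymmetricAlgebra k V →+ SymmetricAlgebra k V :=
    (Φ.symm.toAddEquiv.toAddMonoidHom.comp (MvPolynomial.frobeniusCoord p e (red j))).comp
      Φ.toAddEquiv.toAddMonoidHom
  have hc : ∀ j s, c j s = Φ.symm (MvPolynomial.frobeniusCoord p e (red j) (Φ s)) :=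
    fun _ _ => rfl
  let ℓ (j : Fin (Module.finrank k V) → Fin (p ^ e)) : SymmetricAlgebra k V →ₗ[k] k :=
    MvPolynomial.lcoeff k (red j) ∘ₗ Φ.toLinearMap
  have hℓ : ∀ j s, ℓ j s = MvPolynomial.coeff (red j) (Φ s) := fun _ _ => rfl
  have hsum : ∀ s, ∑ j, c j s ^ p ^ e * Φ.symm (MvPolynomial.monomial (red j) 1) = s := by
    intro s
    apply Φ.injective
    conv_rhs => rw [← MvPolynomial.sum_frobeniusCoord_pow_mul p e (Φ s)]
    rw [map_sum]
    refine Finset.sum_congr rfl fun j _ => ?_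
    rw [map_mul, map_pow, hc, Φ.apply_symm_apply, Φ.apply_symm_apply]
  refine ⟨_, inferInstance, fun j => Φ.symm (MvPolynomial.monomial (red j) 1), c, ℓ,
    fun j => SymmetricAlgebra.gradedComponent B (red j).degree, ?_, hsum, ?_, ?_, ?_⟩
  · intro j t s
    rw [hc, hc, map_mul, map_pow, MvPolynomial.frobeniusCoord_pow_mul, map_mul, Φ.symm_apply_apply]
  · exact fun j g s => SymmetricAlgebra.gradedComponent_symAct B g _ s
  · intro j s
    rw [hc, SymmetricAlgebra.equivMvPolynomial_gradedComponent,
      MvPolynomial.frobeniusCoord_of_isHomogeneous p e j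
        (MvPolynomial.homogeneousComponent_isHomogeneous _ _),
      MvPolynomial.coeff_homogeneousComponent, if_pos rfl, ← map_pow, ← map_pow,
      ← iterateFrobeniusEquiv_def, RingEquiv.apply_symm_apply, hℓ]
    exact Φ.symm.commutes _
  · intro s
    -- `c j s` is congruent modulo `𝔪` to its constant term, a `q`-th root of `ℓ j s`; taking `q`-th
    -- powers gives a congruence modulo `𝔪^[q]`.
    have hmk : ∀ j, Ideal.Quotient.mk (symFrobPower k V p e) (c j s ^ p ^ e) =
        algebraMap k _ (ℓ j s) := by
      intro j
      have hmem : c j s - algebraMap k _ ((iterateFrobeniusEquiv k p e).symm (ℓ j s)) ∈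
          symMaxIdeal k V := by
        rw [SymmetricAlgebra.mem_symMaxIdeal_iff B, ← pow_one (MvPolynomial.idealOfVars _ k),
          MvPolynomial.mem_pow_idealOfVars_iff']
        intro m hm
        have hm0 : m = 0 := (Finsupp.degree_eq_zero_iff m).1 (by omega)
        rw [hm0, map_sub, hc, Φ.apply_symm_apply, MvPolynomial.coeff_sub,
          MvPolynomial.coeff_zero_frobeniusCoord, AlgEquiv.commutes, MvPolynomial.algebraMap_eq,
          MvPolynomial.coeff_zero_C, hℓ, sub_self]
      have h1 := (Ideal.Quotient.mk_eq_mk_iff_sub_mem (I := symFrobPower k V p e) (c j s ^ p ^ e)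
        (algebraMap k _ ((iterateFrobeniusEquiv k p e).symm (ℓ j s)) ^ p ^ e)).2 (by
          rw [← sub_pow_char_pow]
          exact Ideal.subset_span ⟨_, hmem, rfl⟩)
      rw [h1, ← map_pow, ← iterateFrobeniusEquiv_def, RingEquiv.apply_symm_apply]
      rfl
    conv_lhs => rw [← hsum s]
    rw [map_sum]
    refine Finset.sum_congr rfl fun j _ => ?_
    rw [map_mul, hmk]
    exact (Algebra.smul_def _ _).symm

/-! ### Largeness of every `q ≥ #G` -/

section LargeFrobenius

variable {k : Type u} [Field k] {V : Type v} [AddCommGroup V] [Module k V]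

/-- A linear form whose stabiliser in the finite group `G` is trivial. -/
theorem exists_dual_forall_ne_one [Infinite k] (G : Subgroup (V ≃ₗ[k] V)) [Finite G] :
    ∃ ξ : Module.Dual k V, ∀ g ∈ G, g ≠ 1 → ∃ v, ξ (g v) ≠ ξ v := by
  by_contra! hall
  let P (g : {g : G // g ≠ 1}) : Subspace k (Module.Dual k V) :=
    LinearMap.ker (LinearMap.lcomp k k (g.1.1 : V →ₗ[k] V) - LinearMap.id)
  have hP : ∀ g ξ, ξ ∈ P g ↔ ∀ v, ξ (g.1.1 v) = ξ v := by
    intro g ξ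
    rw [LinearMap.mem_ker, LinearMap.sub_apply, sub_eq_zero, LinearMap.ext_iff]
    rfl
  -- A vector space over an infinite field is not a finite union of proper subspaces, so some `g ≠
  -- 1` would fix the whole dual, hence all of `V`.
  obtain ⟨g, hg⟩ := Subspace.exists_eq_top_of_iUnion_eq_univ (p := P) (by
    refine Set.eq_univ_of_forall fun ξ => ?_
    obtain ⟨g, hg, hg1, hv⟩ := hall ξ
    exact Set.mem_iUnion.2 ⟨⟨⟨g, hg⟩, fun h => hg1 (congrArg Subtype.val h)⟩, (hP _ ξ).2 hv⟩)
  apply g.2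
  apply Subtype.ext
  refine LinearEquiv.ext fun v => ?_
  rw [← sub_eq_zero]
  refine (Module.forall_dual_apply_eq_zero_iff k _).1 fun ξ => ?_
  rw [map_sub, sub_eq_zero]
  exact (hP g ξ).1 (hg ▸ Submodule.mem_top) v

theorem symAct_ι (g : V ≃ₗ[k] V) (v : V) :
    symAct g (SymmetricAlgebra.ι k V v) = SymmetricAlgebra.ι k V (g v) := by
  simp [symAct]

/-- Every `q ≥ #G` is large for `G`. -/
theorem isLargeFrob_of_card_le [Infinite k] [FiniteDimensional k V] (G : Subgroup (V ≃ₗ[k] V))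
    [Finite G] (tame : (Nat.card G : k) ≠ 0) (p e : ℕ) (hcard : Nat.card G ≤ p ^ e) :
    IsLargeFrob G p e := by
  classical
  have := Fintype.ofFinite G
  obtain ⟨ξ, hξ⟩ := exists_dual_forall_ne_one G
  choose! v hv using fun g : G => hξ g.1 g.2
  let B := Module.finBasis k V
  let ev : SymmetricAlgebra k V →ₐ[k] k := SymmetricAlgebra.lift ξ
  let a (h : G) : k := (ξ (v h) - ξ (h.1 (v h)))⁻¹
  -- Lagrange interpolation on the orbit of `ξ`: the factor indexed by `h` vanishes at `ξ ∘ h` and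
  -- is normalised to 1 at `ξ`. Omitting `h = 1` keeps the degree at most `#G - 1 < q`.
  let s : SymmetricAlgebra k V := ∏ h ∈ Finset.univ.erase (1 : G),
    algebraMap k _ (a h) * (SymmetricAlgebra.ι k V (v h) - algebraMap k _ (ξ (h.1 (v h))))
  have hs : ∀ g : G, symAct g.1 s = ∏ h ∈ Finset.univ.erase (1 : G), algebraMap k _ (a h) *
      (SymmetricAlgebra.ι k V (g.1 (v h)) - algebraMap k _ (ξ (h.1 (v h)))) := by
    intro g
    simp only [s, map_prod, map_mul, map_sub, AlgHom.commutes, symAct_ι]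
  have hev : ∀ g : G, ev (symAct g.1 s) = if g = 1 then 1 else 0 := by
    intro g
    rw [hs, map_prod]
    simp only [map_mul, map_sub, AlgHom.commutes, ev, SymmetricAlgebra.lift_ι_apply,
      Algebra.algebraMap_self, RingHom.id_apply]
    split_ifs with hg
    · refine Finset.prod_eq_one fun h hh => ?_
      rw [hg]
      refine inv_mul_cancel₀ ?_
      have := hv h fun h1 => (Finset.mem_erase.1 hh).1 (Subtype.ext h1)
      exact sub_ne_zero.2 this.symm
    · exact Finset.prod_eq_zero (Finset.mem_erase.2 ⟨hg, Finset.mem_univ g⟩) (by simp)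
  have hdeg : ∀ g : G,
      (SymmetricAlgebra.equivMvPolynomial B (symAct g.1 s)).totalDegree < p ^ e := by
    intro g
    refine lt_of_lt_of_le ?_ hcard
    rw [hs, map_prod]
    refine lt_of_le_of_lt (MvPolynomial.totalDegree_finsetProd _ _) ?_
    refine lt_of_le_of_lt (Finset.sum_le_card_nsmul _ _ 1 fun h _ => ?_) ?_
    · rw [map_mul, map_sub, AlgEquiv.commutes, AlgEquiv.commutes]
      refine (MvPolynomial.totalDegree_mul _ _).trans ?_
      rw [MvPolynomial.algebraMap_eq, MvPolynomial.totalDegree_C, zero_add]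
      refine (MvPolynomial.totalDegree_sub _ _).trans ?_
      rw [MvPolynomial.totalDegree_C, max_eq_left (Nat.zero_le _)]
      exact (SymmetricAlgebra.equivMvPolynomial_ι_isHomogeneous B _).totalDegree_le
    · rw [smul_eq_mul, mul_one, Finset.card_erase_of_mem (Finset.mem_univ _), Finset.card_univ,
        Nat.card_eq_fintype_card]
      exact Nat.sub_lt Fintype.card_pos one_pos
  -- Evaluation at `ξ` alone need not kill `𝔪^[q]`; truncating to degrees below `q` first makes it
  -- descend, without changing its value on the translates of `s`.
  let L : SymmetricAlgebra k V →ₗ[k] k :=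
    ev.toLinearMap ∘ₗ ∑ n ∈ Finset.range (p ^ e), SymmetricAlgebra.gradedComponent B n
  let l : Module.Dual k (SymmetricAlgebra k V ⧸ symFrobPower k V p e) :=
    { QuotientAddGroup.lift (symFrobPower k V p e).toAddSubgroup L.toAddMonoidHom (fun x hx => by
        change ev ((∑ n ∈ Finset.range (p ^ e), SymmetricAlgebra.gradedComponent B n) x) = 0
        rw [LinearMap.sum_apply, Finset.sum_eq_zero, map_zero]
        intro n hn
        exact SymmetricAlgebra.gradedComponent_eq_zero_of_mem_symFrobPower B p e
          (Finset.mem_range.1 hn) hx) with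
      map_smul' := by
        rintro c ⟨x⟩
        exact L.map_smul c x }
  intro U _ _ _ ρ hρ
  refine exists_retraction_of_matrixCoeff_eq_single tame (frobQuotRep G p e) l
    (Ideal.Quotient.mk _ s) (fun g => ?_) ρ hρ
  rw [← hev g]
  change ev ((∑ n ∈ Finset.range (p ^ e), SymmetricAlgebra.gradedComponent B n)
    (symAct g.1 s)) = _
  rw [LinearMap.sum_apply, SymmetricAlgebra.sum_gradedComponent B _ _ (hdeg g)]

end LargeFrobenius

/-! ### The decompositions of the identity on `S^q` and on `R` -/

section MoritaFrobenius

variable {k : Type u} [Field k] {V : Type v} [AddCommGroup V] [Module k V]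
  (G : Subgroup (V ≃ₗ[k] V)) (p e : ℕ)

/-- If `q` is large, there are elements `s j` of `S` and coordinates `c j` over `S^q` with
`∑ j, c j (g s_j) ^ q = δ_{g, 1}`. -/
theorem exists_frobenius_coordinates_dual [Finite G] (tame : (Nat.card G : k) ≠ 0)
    [Fact p.Prime] [CharP k p] [PerfectRing k p] [FiniteDimensional k V] [DecidableEq G]
    (large : IsLargeFrob G p e) :
    ∃ (J : Type) (_ : Fintype J) (b s : J → SymmetricAlgebra k V)
      (c : J → SymmetricAlgebra k V →+ SymmetricAlgebra k V),
      (∀ j t x, c j (t ^ p ^ e * x) = t * c j x) ∧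
      (∀ x, ∑ j, c j x ^ p ^ e * b j = x) ∧
      (∀ g : G, ∑ j, c j (symAct g.1 (s j)) ^ p ^ e = if g = 1 then 1 else 0) := by
  obtain ⟨J, _, b, c, ℓ, π, hc, hb, hπ, hcπ, hmk⟩ := exists_frobenius_coordinates (k := k) p e V
  let T : (J → SymmetricAlgebra k V) →ₗ[k] (G → k) :=
    LinearMap.pi fun g => ∑ j, ℓ j ∘ₗ (symAct g.1).toLinearMap ∘ₗ LinearMap.proj j
  have hT : ∀ x g, T x g = ∑ j, ℓ j (symAct g.1 (x j)) := fun x g => by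
    simp [T]
  have hle : Submodule.span k {φ | ∃ (l : Module.Dual k _) (w : _),
      φ = fun g => l (frobQuotRep G p e g w)} ≤ LinearMap.range T := by
    refine Submodule.span_le.2 ?_
    rintro _ ⟨l, w, rfl⟩
    obtain ⟨t, rfl⟩ := Ideal.Quotient.mk_surjective w
    -- Expanding `g t` in the classes of the `b j` gives `l(g t) = ∑ ℓ_j(g t) l(b_j)`, which
    -- dictates this preimage.
    refine ⟨fun j => l (Ideal.Quotient.mk _ (b j)) • t, ?_⟩
    ext g
    rw [hT]
    change _ = l (Ideal.Quotient.mk _ (symAct g.1 t))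
    rw [hmk, map_sum]
    refine Finset.sum_congr rfl fun j _ => ?_
    rw [map_smul, map_smul, map_smul, smul_eq_mul, smul_eq_mul, mul_comm]
  obtain ⟨s, hs⟩ := hle (single_one_mem_span_matrixCoeff tame (frobQuotRep G p e)
    fun U _ _ _ ρ hρ => by
      obtain ⟨i, r, hir⟩ := large U ρ hρ
      exact ⟨i, Function.LeftInverse.injective hir⟩)
  -- Projecting `s j` to the graded piece of `b j` commutes with `G` and makes `c_j(g s_j)^q`
  -- exactly the scalar `ℓ_j(g s_j)`, so the identity holds in `S` itself.
  refine ⟨J, inferInstance, b, fun j => π j (s j), c, hc, hb, fun g => ?_⟩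
  have h1 := congrFun hs g
  rw [hT, Pi.single_apply] at h1
  rw [Finset.sum_congr rfl fun j _ => by rw [← hπ, hcπ], ← map_sum, h1]
  split_ifs <;> simp

variable {G p e} in
theorem symAct_apply_of_mem_invariantFrob [Fact p.Prime] [CharP k p] {g : V ≃ₗ[k] V} (hg : g ∈ G)
    {a : SymmetricAlgebra k V} (ha : a ∈ invariantFrob G p e) : symAct g a = a := by
  obtain ⟨f, hf, rfl⟩ := (mem_invariantFrob G p e).1 ha
  rw [map_pow, hf g hg]

/-- The `R^q`-linear map `R → S^q`, `x ↦ c(x)^q`, for a `q⁻¹`-linear map `c : S → S`. -/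
noncomputable def invariantModuleCoord [Fact p.Prime] [CharP k p]
    (c : SymmetricAlgebra k V →+ SymmetricAlgebra k V)
    (hc : ∀ t x, c (t ^ p ^ e * x) = t * c x) :
    invariantModule G p e →ₗ[invariantFrob G p e] symFrobModule G p e where
  toFun x := ⟨c x ^ p ^ e, c x, rfl⟩
  map_add' x y := Subtype.ext <| by
    change c ((x : SymmetricAlgebra k V) + y) ^ p ^ e = c x ^ p ^ e + c y ^ p ^ e
    rw [map_add, add_pow_char_pow]
  map_smul' := by
    rintro ⟨_, f, hf, rfl⟩ x
    apply Subtype.ext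
    change c (f ^ p ^ e * (x : SymmetricAlgebra k V)) ^ p ^ e = f ^ p ^ e * c x ^ p ^ e
    rw [hc, mul_pow]

/-- The `R^q`-linear map `S^q → R`, `a ↦ ∑ g, g (a s)`. -/
noncomputable def symFrobModuleTrace [Fintype G] [Fact p.Prime] [CharP k p]
    (s : SymmetricAlgebra k V) :
    symFrobModule G p e →ₗ[invariantFrob G p e] invariantModule G p e where
  toFun a := ⟨∑ g : G, symAct g.1 (a * s), fun h hh => by
    rw [map_sum]
    refine Fintype.sum_equiv (Equiv.mulLeft (⟨h, hh⟩ : G)) _ _ fun g => ?_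
    change _ = symAct (h * g.1) _
    rw [symAct_mul]; rfl⟩
  map_add' a b := Subtype.ext <| by
    change ∑ g : G, symAct g.1 (((a : SymmetricAlgebra k V) + b) * s) =
      ∑ g : G, symAct g.1 (a * s) + ∑ g : G, symAct g.1 (b * s)
    simp only [add_mul, map_add, Finset.sum_add_distrib]
  map_smul' r a := Subtype.ext <| by
    change ∑ g : G, symAct g.1 (((r : SymmetricAlgebra k V) * a) * s) =
      (r : SymmetricAlgebra k V) * ∑ g : G, symAct g.1 (a * s)
    rw [Finset.mul_sum]
    refine Finset.sum_congr rfl fun g _ => ?_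
    rw [mul_assoc, map_mul, symAct_apply_of_mem_invariantFrob g.2 r.2]

/-- For `q` large, the Morita equivalence between `End_{R^q}(S^q)` and `D_{R,e}`. -/
theorem IsLargeFrob.exists_moritaEquivalence [Finite G] (tame : (Nat.card G : k) ≠ 0)
    [Fact p.Prime] [CharP k p] [PerfectRing k p] [FiniteDimensional k V]
    (large : IsLargeFrob G p e) :
    ∃ E : MoritaEquivalence (invariantFrob G p e) (symFrobEnd G p e) (diffOpRing G p e),
      E.eqv.functor = homTensorFunctor (invariantFrob G p e)
        (symFrobModule G p e) (invariantModule G p e) ∧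
      E.eqv.inverse = homTensorFunctor (invariantFrob G p e)
        (invariantModule G p e) (symFrobModule G p e) := by
  classical
  have := Fintype.ofFinite G
  obtain ⟨J, _, b, s, c, hc, hb, hs⟩ := exists_frobenius_coordinates_dual G p e tame large
  -- `S^q` passes through `R` by traces against the dual elements `s j`, then coordinates. `R`
  -- passes through `S^q` by coordinates, then traces against `b j`, normalised by `1/#G` to give
  -- the Reynolds average.
  refine exists_moritaEquivalence_homTensorFunctor
    (fun j => symFrobModuleTrace G p e (s j)) (fun j => invariantModuleCoord G p e (c j) (hc j)) ?_
    (fun j => invariantModuleCoord G p e (c j) (hc j))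
    (fun j => symFrobModuleTrace G p e ((Nat.card G : k)⁻¹ • b j)) ?_
  · rintro ⟨_, t, rfl⟩
    apply Subtype.ext
    rw [AddSubmonoidClass.coe_finsetSum]
    change ∑ j, c j (∑ g : G, symAct g.1 (t ^ p ^ e * s j)) ^ p ^ e = t ^ p ^ e
    have h1 : ∀ j, c j (∑ g : G, symAct g.1 (t ^ p ^ e * s j)) ^ p ^ e =
        ∑ g : G, symAct g.1 t ^ p ^ e * c j (symAct g.1 (s j)) ^ p ^ e := by
      intro j
      rw [map_sum, sum_pow_char_pow]
      refine Finset.sum_congr rfl fun g _ => ?_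
      rw [map_mul, map_pow, hc, mul_pow]
    rw [Finset.sum_congr rfl fun j _ => h1 j, Finset.sum_comm]
    simp only [← Finset.mul_sum, hs, mul_ite, mul_one, mul_zero]
    rw [Finset.sum_ite_eq' Finset.univ (1 : G), if_pos (Finset.mem_univ _)]
    change symAct (1 : V ≃ₗ[k] V) t ^ p ^ e = _
    rw [symAct_one, AlgHom.id_apply]
  · rintro ⟨x, hx⟩
    apply Subtype.ext
    rw [AddSubmonoidClass.coe_finsetSum]
    change ∑ j, ∑ g : G, symAct g.1 (c j x ^ p ^ e * ((Nat.card G : k)⁻¹ • b j)) = x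
    rw [Finset.sum_comm]
    have h1 : ∀ g : G, ∑ j, symAct g.1 (c j x ^ p ^ e * ((Nat.card G : k)⁻¹ • b j)) =
        (Nat.card G : k)⁻¹ • x := by
      intro g
      rw [← map_sum]
      simp only [mul_smul_comm]
      rw [← Finset.smul_sum, hb, map_smul, hx g.1 g.2]
    rw [Finset.sum_congr rfl fun g _ => h1 g, Finset.sum_const, Finset.card_univ,
      ← Nat.card_eq_fintype_card, ← Nat.cast_smul_eq_nsmul k, smul_smul, mul_inv_cancel₀ tame,
      one_smul]

end MoritaFrobenius

/-! ### Frobenius identification of `End_R(S)` with `End_{R^q}(S^q)` -/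

section Comparison

/-- An additive functor is `ℤ`-linear, for any `ℤ`-linear structures on the categories. -/
theorem CategoryTheory.Functor.linear_int {C D : Type*} [Category* C] [Category* D]
    [Preadditive C] [Preadditive D] [CategoryTheory.Linear ℤ C]
    [CategoryTheory.Linear ℤ D] (F : C ⥤ D) [F.Additive] :
    F.Linear ℤ where
  map_smul {X Y} f n :=
    (congrArg F.map (int_smul_eq_zsmul (CategoryTheory.Linear.homModule X Y) n f)).trans
      (F.map_zsmul.trans
        (int_smul_eq_zsmul (CategoryTheory.Linear.homModule (F.obj X) (F.obj Y)) n
          (F.map f)).symm)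

/-- A Morita equivalence of `R`-algebras is a Morita equivalence of rings. -/
theorem MoritaEquivalence.isMoritaEquivalent_int {R : Type u} [CommRing R] {A : Type v} [Ring A]
    [Algebra R A] {B : Type w} [Ring B] [Algebra R B] (E : MoritaEquivalence R A B) :
    IsMoritaEquivalent ℤ A B :=
  ⟨⟨{ eqv := E.eqv
      linear := @Functor.linear_int _ _ _ _ _ _ ModuleCat.Algebra.instLinear
        ModuleCat.Algebra.instLinear E.eqv.functor _ }⟩⟩

variable {k : Type u} [Field k] {V : Type v} [AddCommGroup V] [Module k V]
  (G : Subgroup (V ≃ₗ[k] V)) (p e : ℕ) [Fact p.Prime] [CharP k p]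

/-- The Frobenius isomorphism `R ≃ R^q`. -/
noncomputable def invariantRingEquivFrob : invariantRing G ≃+* invariantFrob G p e :=
  (invariantRing G).toSubring.equivMapOfInjective
    (iterateFrobenius (SymmetricAlgebra k V) p e) (iterateFrobenius_inj _ p e)

/-- The Frobenius isomorphism `S ≃ S^q`, semilinear over `R ≃ R^q`. -/
noncomputable def symEquivFrobModule :
    letI := RingHomInvPair.of_ringEquiv (invariantRingEquivFrob G p e)
    letI := RingHomInvPair.of_ringEquiv (invariantRingEquivFrob G p e).symm
    SymmetricAlgebra k V ≃ₛₗ[((invariantRingEquivFrob G p e : invariantRing G ≃+* invariantFrob G p e) :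
      invariantRing G →+* invariantFrob G p e)]
      symFrobModule G p e :=
  letI := RingHomInvPair.of_ringEquiv (invariantRingEquivFrob G p e)
  letI := RingHomInvPair.of_ringEquiv (invariantRingEquivFrob G p e).symm
  { toFun := fun x => (⟨x ^ p ^ e, x, rfl⟩ : symFrobModule G p e)
    map_add' := fun x y => Subtype.ext (add_pow_char_pow x y p e)
    map_smul' := fun r x => Subtype.ext (mul_pow (r : SymmetricAlgebra k V) x (p ^ e))
    invFun := fun y => y.2.choose
    left_inv := fun x => iterateFrobenius_inj (SymmetricAlgebra k V) p e
      (Exists.choose_spec (p := fun f : SymmetricAlgebra k V => f ^ p ^ e = x ^ p ^ e) _)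
    right_inv := fun y => Subtype.ext y.2.choose_spec }

/-- `End_R(S)` and `End_{R^q}(S^q)` are isomorphic rings. -/
theorem nonempty_end_ringEquiv_symFrobEnd :
    Nonempty (Module.End (invariantRing G) (SymmetricAlgebra k V) ≃+* symFrobEnd G p e) :=
  letI := RingHomInvPair.of_ringEquiv (invariantRingEquivFrob G p e)
  letI := RingHomInvPair.of_ringEquiv (invariantRingEquivFrob G p e).symm
  ⟨(symEquivFrobModule G p e).conjRingEquiv⟩

end Comparison

theorem mainTheorem1 {k : Type u} [Field k] [IsAlgClosed k] (p : ℕ) [Fact p.Prime] [CharP k p]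
    {V : Type v} [AddCommGroup V] [Module k V] [FiniteDimensional k V]
    (G : Subgroup (V ≃ₗ[k] V)) [Finite G] (tame : ¬ p ∣ Nat.card G) :
    (∀ e : ℕ, IsLargeFrob G p e →
      (∃ E : MoritaEquivalence (invariantFrob G p e) (symFrobEnd G p e) (diffOpRing G p e),
        E.eqv.functor = homTensorFunctor (invariantFrob G p e)
          (symFrobModule G p e) (invariantModule G p e) ∧
        E.eqv.inverse = homTensorFunctor (invariantFrob G p e)
          (invariantModule G p e) (symFrobModule G p e)) ∧
      IsMoritaEquivalent ℤ
        (Module.End (invariantRing G) (SymmetricAlgebra k V)) (diffOpRing G p e)) ∧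
    (∃ e₀ : ℕ, ∀ e : ℕ, e₀ ≤ e → IsLargeFrob G p e) ∧
    (IsMulCommutative G → ∀ e : ℕ, Nat.card G ≤ p ^ e → IsLargeFrob G p e) := by
  have tame' : (Nat.card G : k) ≠ 0 := fun h => tame ((CharP.cast_eq_zero_iff k p _).1 h)
  have : Infinite k := IsAlgClosed.instInfinite
  -- `e₀ = #G` works because `e < p^e`.
  refine ⟨fun e large => ?_, ⟨Nat.card G, fun e he => ?_⟩, fun _ e he => ?_⟩
  · obtain ⟨E, hE⟩ := large.exists_moritaEquivalence G p e tame'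
    obtain ⟨φ⟩ := nonempty_end_ringEquiv_symFrobEnd G p e
    -- The isomorphism `φ` twists scalars by Frobenius, so the composite equivalence is taken over
    -- `ℤ`.
    exact ⟨⟨E, hE⟩, IsMoritaEquivalent.trans ℤ (IsMoritaEquivalent.of_algEquiv ℤ φ.toIntAlgEquiv)
      E.isMoritaEquivalent_int⟩
  · exact isLargeFrob_of_card_le G tame' p e
      (he.trans (Nat.lt_pow_self (Fact.out : p.Prime).one_lt).le)
  · exact isLargeFrob_of_card_le G tame' p e he
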